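/- Let $X_0,\dots,X_m$ be compact complex manifolds, and for $1\le j\le m$ let $f_j\colon X_j\to X_{j-1}$ be the blow-up of $X_{j-1}$ along a closed complex submanifold $V_{j-1}\subset X_{j-1}$ of positive codimension. Put $f:=f_1\circ\cdots\circ f_m\colon X_m\to X_0$ (the identity if $m=0$). Let $g_0$ and $g_m$ be arbitrary smooth Riemannian metrics on $X_0$ and $X_m$ (independent of each other, also when $m=0$), with induced distances $d_{g_0}$ and $d_{g_m}$, and let $M>0$. For a manifold $X$ with a Riemannian metric $g$, a function $v\colon X\to\mathbb R$ is called $\log^M$-continuous with respect to $g$ if there is a constant $C>0$ such that $$|v(x)-v(y)|\le \frac{C}{|\log d_g(x,y)|^{M}}$$ for all $x,y$ in the same connected component of $X$, where the right-hand side is read as $+\infty$ if $d_g(x,y)=1$ and as $0$ if $x=y$. Then for every function $u\colon X_0\to\mathbb R$: if $u\circ f$ is $\log^M$-continuous on $X_m$ with respect to $g_m$, then $u$ is $\log^M$-continuous on $X_0$ with respect to $g_0$. -/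

import Mathlib

open scoped Manifold ContDiff ENNReal Bundle

namespace LogBlowUp

/-- The coordinate space `ℂⁿ` on which complex manifolds of dimension `n` are modelled. -/
abbrev Cn (n : ℕ) : Type := EuclideanSpace ℂ (Fin n)

/-- A complex manifold of dimension `n` is, by restriction of scalars, a real manifold
(modelled on the real vector space underlying `ℂⁿ`). -/
instance instIsManifoldReal (n : ℕ) (X : Type*) [TopologicalSpace X] [ChartedSpace (Cn n) X]
    [IsManifold 𝓘(ℂ, Cn n) ω X] : IsManifold 𝓘(ℝ, Cn n) ω X := by
  apply isManifold_of_contDiffOn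
  intro e e' he he'
  have h := (contDiffGroupoid ω 𝓘(ℂ, Cn n)).compatible he he'
  rw [contDiffGroupoid, mem_groupoid_of_pregroupoid] at h
  exact ContDiffOn.restrict_scalars ℝ h.1

section Metric

variable (n : ℕ) (X : Type*) [TopologicalSpace X] [ChartedSpace (Cn n) X]
  [IsManifold 𝓘(ℂ, Cn n) ω X]

/-- A smooth Riemannian metric on the real manifold underlying the complex manifold `X`. -/
abbrev SmoothMetric : Type _ :=
  Bundle.ContMDiffRiemannianMetric 𝓘(ℝ, Cn n) ∞ (Cn n)
    (fun x : X => TangentSpace 𝓘(ℝ, Cn n) x)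

variable {n X}

/-- The distance of a Riemannian metric `g`: the infimum of the `g`-lengths of the `C¹` paths from
`x` to `y`. It is `∞` exactly for points in different components. -/
noncomputable def metricEDist (g : SmoothMetric n X) (x y : X) : ℝ≥0∞ :=
  letI : Bundle.RiemannianBundle (fun x : X => TangentSpace 𝓘(ℝ, Cn n) x) :=
    ⟨g.toRiemannianMetric⟩
  Manifold.riemannianEDist 𝓘(ℝ, Cn n) x y

/-- `u` is `log^M`-continuous with respect to `g`: there is `C > 0` with
`|u x - u y| ≤ C / |log dist(x, y)| ^ M` for all `x`, `y`.
The right-hand side is read as `∞` (no condition) when `dist(x, y) = 1`, and as `0` when `x = y`;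
on a manifold with several components only points of the same component are compared. -/
def LogContinuous (g : SmoothMetric n X) (M : ℝ) (u : X → ℝ) : Prop :=
  ∃ C : ℝ, 0 < C ∧ ∀ x y : X, metricEDist g x y ≠ ⊤ → metricEDist g x y ≠ 1 →
    |u x - u y| ≤ C / |Real.log (metricEDist g x y).toReal| ^ M

end Metric

section BlowUp

variable {n : ℕ}

/-- The blow-up of `ℂⁿ` along the linear subspace `{x_i = 0 for all i ∈ S}`: the pairs `(x, [v])`
with `x_i v_j = x_j v_i` for `i, j ∈ S`, where `v = (v_i)_{i ∈ S}` are homogeneous coordinates. -/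
def modelBlowUp (S : Finset (Fin n)) : Set (Cn n × Projectivization ℂ (S → ℂ)) :=
  {p | ∀ i j : S, p.1 i * p.2.rep j = p.1 j * p.2.rep i}

open Classical in
/-- The standard affine coordinates on the open subset `{v_i ≠ 0}` of the model blow-up:
`w_i = x_i`, `w_s = v_s / v_i` for `s ∈ S`, `s ≠ i`, and `w_s = x_s` for `s ∉ S`. -/
noncomputable def modelCoord {S : Finset (Fin n)} (i : S)
    (p : Cn n × Projectivization ℂ (S → ℂ)) : Cn n :=
  WithLp.toLp 2 fun s : Fin n =>
    if h : s ∈ S then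
      if s = i then p.1 s else p.2.rep ⟨s, h⟩ / p.2.rep i
    else p.1 s

/-- `φ` is a holomorphic chart of `X` in which `V` is the linear subspace `{x_i = 0, i ∈ S}`. -/
def IsFlatChart {X : Type*} [TopologicalSpace X] [ChartedSpace (Cn n) X]
    (V : Set X) (S : Finset (Fin n)) (φ : OpenPartialHomeomorph X (Cn n)) : Prop :=
  φ ∈ IsManifold.maximalAtlas 𝓘(ℂ, Cn n) ω X ∧
    ∀ x ∈ φ.source, x ∈ V ↔ ∀ i ∈ S, φ x i = 0

variable {X Y : Type*} [TopologicalSpace X] [ChartedSpace (Cn n) X]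
  [TopologicalSpace Y] [ChartedSpace (Cn n) Y]

/-- Over the domain of the flat chart `φ`, the map `f` is the model blow-up: for some `q`, the map
`y ↦ (φ (f y), q y)` is a biholomorphism from the preimage of the domain of `φ` onto the part of the
model blow-up lying over the image of `φ`. The complex structure of the model is given by its
standard affine coordinates, which therefore have to be holomorphic charts of `Y`. -/
def IsModelBlowUpOver (f : Y → X) (S : Finset (Fin n))
    (φ : OpenPartialHomeomorph X (Cn n)) : Prop :=
  ∃ q : Y → Projectivization ℂ (S → ℂ),
    Set.BijOn (fun y => (φ (f y), q y)) (f ⁻¹' φ.source) {p ∈ modelBlowUp S | p.1 ∈ φ.target} ∧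
    ∀ i : S, ∃ ψ ∈ IsManifold.maximalAtlas 𝓘(ℂ, Cn n) ω Y,
      ψ.source = {y | f y ∈ φ.source ∧ (q y).rep i ≠ 0} ∧
      ∀ y ∈ ψ.source, ψ y = modelCoord i (φ (f y), q y)

/-- `f : Y → X` is the blow-up of `X` along the closed complex submanifold `V` of positive
codimension: `f` is holomorphic, biholomorphic over `X \ V`, and near every point of `V` it is the
model blow-up in some flat chart. -/
structure IsBlowUp (V : Set X) (f : Y → X) : Prop where
  isClosed : IsClosed V
  holomorphic : ContMDiff 𝓘(ℂ, Cn n) 𝓘(ℂ, Cn n) ω f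
  biholomorphic_compl : ∃ h : X → Y, ContMDiffOn 𝓘(ℂ, Cn n) 𝓘(ℂ, Cn n) ω h Vᶜ ∧
    (∀ x ∉ V, f (h x) = x) ∧ ∀ y, f y ∉ V → h (f y) = y
  local_model : ∀ ξ ∈ V, ∃ (S : Finset (Fin n)) (φ : OpenPartialHomeomorph X (Cn n)),
    S.Nonempty ∧ ξ ∈ φ.source ∧ IsFlatChart V S φ ∧ IsModelBlowUpOver f S φ

end BlowUp

/-- For maps `f j : X (j + 1) → X j`, the composition `X j → X 0` of the first `j` of them. -/
def compMaps {m : ℕ} {X : Fin (m + 1) → Type*} (f : ∀ j : Fin m, X j.succ → X j.castSucc)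
    (j : Fin (m + 1)) : X j → X 0 :=
  Fin.induction (motive := fun j => X j → X 0) id (fun j F => F ∘ f j) j

end LogBlowUp

/-!
Continuity with modulus `ω(t) = 1 / |log t| ^ M` descends along a composition of blow-ups because
`ω` is insensitive to taking powers: `ω(A √t)` is at most a constant multiple of `ω(t)` for small
`t` (`logModulus_le_of_le_sqrt`). A function on the base is therefore controlled as soon as points
at distance `δ` can be joined by a bounded number of steps, each of which lifts to a step of length
`O(√δ)` upstairs.

On a compact manifold, `log^M`-continuity with respect to any Riemannian metric amounts to local
`log^M`-continuity in holomorphic charts, since the charts are locally bi-Lipschitz for the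
Riemannian distance (`exists_riemannianEDist_le_edist_extChartAt`,
`exists_edist_extChartAt_le_riemannianEDist`). This notion, `LogContinuousInCharts`, involves no
metric, so no metrics on the intermediate manifolds have to be chosen, and one blow-up `f : Y → X`
can be treated at a time (`IsBlowUp.logContinuousInCharts`).

Outside the center, `f` has a holomorphic local inverse. Near a point of the center, `f` is the
model blow-up of `ℂⁿ` along `{x_s = 0, s ∈ S}`, and the statement is
`logContinuousNear_of_modelBlowDown`: let `x`, `y` be at distance `δ`. If `x` is at distance at
least `√δ` from the center, the directions `[x_S]` and `[y_S]` are `O(√δ)`-close and so are the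
lifts of `x` and `y`. Otherwise both points are `O(√δ)`-close to their projections to the center,
and the lifts of `x` and of its projection with the same direction `[x_S]` are as close; finally
the two projections are joined inside the center with a constant direction. Choosing the affine
chart of the largest coordinate of the direction keeps all lifts in compact subsets of the charts,
so that the constants are uniform.
-/

namespace LogBlowUp

/-! ### Riemannian distance and distance in a chart -/

section Riemannian

open Manifold Set MeasureTheory Filter Topology Metric Bundle
open scoped NNReal

variable {E : Type*} [NormedAddCommGroup E] [NormedSpace ℝ E]
  {H : Type*} [TopologicalSpace H] (I : ModelWithCorners ℝ E H)
  {N : Type*} [TopologicalSpace N] [ChartedSpace H N]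
  [RiemannianBundle (fun (x : N) ↦ TangentSpace I x)]
  [IsManifold I 1 N] [IsContinuousRiemannianBundle E (fun (x : N) ↦ TangentSpace I x)]

-- the tangent spaces of the model vector space carry the norm of the vector space
attribute [local instance] normedAddCommGroupTangentSpaceVectorSpace
  normedSpaceTangentSpaceVectorSpace

theorem eventually_enorm_mfderiv_extChartAt_apply_le (x : N) :
    ∃ C > (0 : ℝ≥0), ∀ᶠ y in 𝓝 x, ∀ v : TangentSpace I y,
      ‖mfderiv% (extChartAt I x) y v‖ₑ ≤ C * ‖v‖ₑ := by
  obtain ⟨C, C_pos, hC⟩ := eventually_enorm_mfderiv_extChartAt_lt I x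
  exact ⟨C, C_pos, hC.mono fun y hy v => ContinuousLinearMap.le_of_opENorm_le _ hy.le v⟩

theorem eventually_enorm_mfderivWithin_symm_extChartAt_apply_le (x : N) :
    ∃ C > (0 : ℝ≥0), ∀ᶠ y in 𝓝[range I] (extChartAt I x x), ∀ v : TangentSpace 𝓘(ℝ, E) y,
      ‖mfderiv[range I] (extChartAt I x).symm y v‖ₑ ≤ C * ‖v‖ₑ := by
  obtain ⟨C, C_pos, hC⟩ := eventually_enorm_mfderivWithin_symm_extChartAt_lt I x
  exact ⟨C, C_pos, hC.mono fun y hy v => ContinuousLinearMap.le_of_opENorm_le _ hy.le v⟩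

/-- Near `x` the inverse of the extended chart is Lipschitz, as a two-point estimate: the
segment between the images of `y` and `z` stays in a ball on which the derivative of the inverse
chart is bounded, and its preimage is a path from `y` to `z`. -/
theorem exists_riemannianEDist_le_edist_extChartAt (x : N) :
    ∃ C > (0 : ℝ≥0), ∃ s ∈ 𝓝 x, ∀ y ∈ s, ∀ z ∈ s,
      riemannianEDist I y z ≤ C * edist (extChartAt I x y) (extChartAt I x z) := by
  obtain ⟨C, C_pos, hC⟩ := eventually_enorm_mfderivWithin_symm_extChartAt_apply_le I x
  refine ⟨C, C_pos, ?_⟩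
  obtain ⟨r, r_pos, hr⟩ : ∃ r > 0,
      ball (extChartAt I x x) r ∩ range I ⊆ (extChartAt I x).target ∩
        {y | ∀ v : TangentSpace 𝓘(ℝ, E) y,
          ‖mfderiv[range I] (extChartAt I x).symm y v‖ₑ ≤ C * ‖v‖ₑ} :=
    mem_nhdsWithin_iff.1 (inter_mem (extChartAt_target_mem_nhdsWithin x) hC)
  have A : (extChartAt I x) ⁻¹' (ball (extChartAt I x x) r ∩ range I) ∈ 𝓝 x := by
    apply extChartAt_preimage_mem_nhds_of_mem_nhdsWithin (by simp)
    rw [inter_comm]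
    exact inter_mem_nhdsWithin _ (ball_mem_nhds _ r_pos)
  refine ⟨_, inter_mem A (chart_source_mem_nhds H x), ?_⟩
  rintro y ⟨hy, h'y⟩ z ⟨hz, h'z⟩
  let η := ContinuousAffineMap.lineMap (R := ℝ) (extChartAt I x y) (extChartAt I x z)
  set γ := (extChartAt I x).symm ∘ η
  have hη : Icc 0 1 ⊆ ⇑η ⁻¹' ((extChartAt I x).target ∩
        {y | ∀ v : TangentSpace 𝓘(ℝ, E) y,
          ‖mfderiv[range I] (extChartAt I x).symm y v‖ₑ ≤ C * ‖v‖ₑ}) := by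
    simp only [← image_subset_iff, ContinuousAffineMap.coe_lineMap_eq,
     ← segment_eq_image_lineMap, η]
    apply Subset.trans _ hr
    exact ((convex_ball _ _).inter I.convex_range).segment_subset hy hz
  simp only [preimage_inter, subset_inter_iff] at hη
  have η_smooth : CMDiff[Icc 0 1] 1 η := by
    apply ContMDiff.contMDiffOn
    rw [contMDiff_iff_contDiff]
    exact ContinuousAffineMap.contDiff _
  have : riemannianEDist I y z ≤ pathELength I γ 0 1 := by
    apply riemannianEDist_le_pathELength _ _ _ zero_le_one
    · exact (contMDiffOn_extChartAt_symm x).comp η_smooth hη.1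
    · simp [γ, η, ContinuousAffineMap.coe_lineMap_eq, h'y]
    · simp [γ, η, ContinuousAffineMap.coe_lineMap_eq, h'z]
  apply this.trans
  rw [← lintegral_fderiv_lineMap_eq_edist, pathELength_eq_lintegral_mfderivWithin_Icc,
    ← lintegral_const_mul' _ _ ENNReal.coe_ne_top]
  apply setLIntegral_mono' measurableSet_Icc (fun t ht ↦ ?_)
  have : mfderiv[Icc 0 1] γ t =
      (mfderiv[range I] (extChartAt I x).symm (η t)) ∘L (mfderiv[Icc 0 1] η t) := by
    apply mfderivWithin_comp
    · exact mdifferentiableWithinAt_extChartAt_symm (hη.1 ht)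
    · exact η_smooth.mdifferentiableOn one_ne_zero t ht
    · exact hη.1.trans (preimage_mono (extChartAt_target_subset_range x))
    · rw [uniqueMDiffWithinAt_iff_uniqueDiffWithinAt]
      exact uniqueDiffOn_Icc zero_lt_one t ht
  have : mfderiv[Icc 0 1] γ t 1 =
      (mfderiv[range I] (extChartAt I x).symm (η t)) (mfderiv[Icc 0 1] η t 1) := congr($this 1)
  rw [this]
  refine (hη.2 ht _).trans_eq ?_
  simp only [mfderivWithin_eq_fderivWithin]
  rfl

/-- Near `x` the extended chart is Lipschitz for the Riemannian distance, as a two-point estimate: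
a nearly shortest path between two points close to `x` cannot leave the neighbourhood of `x` on
which the derivative of the chart is bounded. -/
theorem exists_edist_extChartAt_le_riemannianEDist [RegularSpace N] (x : N) :
    ∃ C > (0 : ℝ≥0), ∃ s ∈ 𝓝 x, ∀ y ∈ s, ∀ z ∈ s,
      edist (extChartAt I x y) (extChartAt I x z) ≤ C * riemannianEDist I y z := by
  obtain ⟨C, C_pos, hC⟩ := eventually_enorm_mfderiv_extChartAt_apply_le I x
  obtain ⟨c, c_pos, hc⟩ := setOfPred_riemannianEDist_lt_subset_nhds I
    (inter_mem hC (chart_source_mem_nhds H x))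
  have c4 : (0 : ℝ≥0∞) < ((c / 4 : ℝ≥0) : ℝ≥0∞) := by
    rw [ENNReal.coe_pos]; positivity
  refine ⟨C, C_pos, _, eventually_riemannianEDist_lt I x c4, ?_⟩
  intro y hy z hz
  have hyz : riemannianEDist I y z < ((c / 2 : ℝ≥0) : ℝ≥0∞) := by
    calc riemannianEDist I y z ≤ riemannianEDist I y x + riemannianEDist I x z :=
          riemannianEDist_triangle
      _ < ((c / 4 : ℝ≥0) : ℝ≥0∞) + ((c / 4 : ℝ≥0) : ℝ≥0∞) := by
          rw [riemannianEDist_comm (x := y)]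
          exact ENNReal.add_lt_add hy hz
      _ = ((c / 2 : ℝ≥0) : ℝ≥0∞) := by
          rw [← ENNReal.coe_add]; congr 1; ring
  by_contra! h
  have C0 : (C : ℝ≥0∞) ≠ 0 := by exact_mod_cast C_pos.ne'
  have h' : riemannianEDist I y z < edist (extChartAt I x y) (extChartAt I x z) / C := by
    rwa [ENNReal.lt_div_iff_mul_lt (Or.inl C0) (Or.inl ENNReal.coe_ne_top), mul_comm]
  obtain ⟨γ, hγy, hγz, γ_smooth, hγ, -⟩ :=
    exists_lt_locally_constant_of_riemannianEDist_lt (lt_min h' hyz) zero_lt_one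
  -- a path from `y` to `z` of length less than `c / 2` stays in the ball of radius `c` around `x`
  have hmem : ∀ t ∈ Icc (0 : ℝ) 1, (∀ v : TangentSpace I (γ t),
      ‖mfderiv% (extChartAt I x) (γ t) v‖ₑ ≤ C * ‖v‖ₑ) ∧ γ t ∈ (chartAt H x).source := by
    intro t ht
    apply hc
    calc riemannianEDist I x (γ t) ≤ riemannianEDist I x y + riemannianEDist I y (γ t) :=
          riemannianEDist_triangle
      _ < ((c / 4 : ℝ≥0) : ℝ≥0∞) + ((c / 2 : ℝ≥0) : ℝ≥0∞) := by
          refine ENNReal.add_lt_add hy ?_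
          calc riemannianEDist I y (γ t) ≤ pathELength I γ 0 t :=
                riemannianEDist_le_pathELength γ_smooth.contMDiffOn hγy rfl ht.1
            _ ≤ pathELength I γ 0 1 := pathELength_mono le_rfl ht.2
            _ < _ := hγ.trans_le (min_le_right _ _)
      _ ≤ c := by
          rw [← ENNReal.coe_add, ENNReal.coe_le_coe, ← NNReal.coe_le_coe]
          push_cast
          have := c.2
          change (0 : ℝ) ≤ c at this
          linarith
  let γ' := extChartAt I x ∘ γ
  have hγ' : CMDiff[Icc 0 1] 1 γ' :=
    contMDiffOn_extChartAt.comp (I' := I) (t := (chartAt H x).source)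
      γ_smooth.contMDiffOn (fun t ht ↦ (hmem t ht).2)
  apply lt_irrefl (edist (extChartAt I x y) (extChartAt I x z))
  calc
    edist (extChartAt I x y) (extChartAt I x z) = ‖γ' 1 - γ' 0‖ₑ := by
      rw [edist_comm, edist_eq_enorm_sub]
      simp [γ', hγy, hγz]
    _ ≤ ∫⁻ t in Icc 0 1, ‖derivWithin γ' (Icc 0 1) t‖ₑ := by
      apply enorm_sub_le_lintegral_derivWithin_Icc_of_contDiffOn_Icc _ zero_le_one
      rwa [← contMDiffOn_iff_contDiffOn]
    _ = ∫⁻ t in Icc 0 1, ‖mfderiv[Icc 0 1] γ' t 1‖ₑ := by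
      simp_rw [← fderivWithin_derivWithin, mfderivWithin_eq_fderivWithin]
      rfl
    _ ≤ ∫⁻ t in Icc 0 1, C * ‖mfderiv[Icc 0 1] γ t 1‖ₑ := by
      apply setLIntegral_mono' measurableSet_Icc (fun t ht ↦ ?_)
      have : mfderiv[Icc 0 1] γ' t =
          (mfderiv% (extChartAt I x) (γ t)) ∘L (mfderiv[Icc 0 1] γ t) := by
        apply mfderiv_comp_mfderivWithin
        · exact mdifferentiableAt_extChartAt (hmem t ht).2
        · exact (γ_smooth.mdifferentiable one_ne_zero).mdifferentiableOn _ ht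
        · rw [uniqueMDiffWithinAt_iff_uniqueDiffWithinAt]
          exact uniqueDiffOn_Icc zero_lt_one _ ht
      have : mfderiv[Icc 0 1] γ' t 1 =
          (mfderiv% (extChartAt I x) (γ t)) (mfderiv[Icc 0 1] γ t 1) :=
        congr($this 1)
      rw [this]
      exact (hmem t ht).1 _
    _ = C * pathELength I γ 0 1 := by
      rw [lintegral_const_mul' _ _ ENNReal.coe_ne_top,
          pathELength_eq_lintegral_mfderivWithin_Icc]
    _ < C * (edist (extChartAt I x y) (extChartAt I x z) / C) :=
      ENNReal.mul_lt_mul_right C0 ENNReal.coe_ne_top (hγ.trans_le (min_le_left _ _))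
    _ = edist (extChartAt I x y) (extChartAt I x z) :=
      ENNReal.mul_div_cancel C0 ENNReal.coe_ne_top

end Riemannian

/-! ### The modulus of continuity -/

section Modulus

open Metric Filter Topology

/-- The modulus of continuity `t ↦ 1 / |log t| ^ M`. For `M > 0` its value at `0` is `0`, as it
should be; the value at `1` is `0` too instead of `∞`, so it is only meaningful for `t < 1`. -/
noncomputable def logModulus (M t : ℝ) : ℝ := 1 / |Real.log t| ^ M

theorem logModulus_nonneg (M t : ℝ) : 0 ≤ logModulus M t := by
  unfold logModulus; positivity

theorem logModulus_zero {M : ℝ} (hM : 0 < M) : logModulus M 0 = 0 := by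
  simp [logModulus, Real.zero_rpow hM.ne']

/-- The modulus does not distinguish between `s` and `A √s`, up to a constant factor: for small `s`
one has `|log (A √s)| ≥ |log s| / 4`. -/
theorem logModulus_le_of_le_sqrt {M A : ℝ} (hM : 0 < M) (hA : 0 < A) :
    ∃ s₀ > 0, ∀ s t, 0 ≤ t → s ≤ s₀ → t ≤ A * √s →
      logModulus M t ≤ 4 ^ M * logModulus M s := by
  refine ⟨min (1 / 2) (A⁻¹ ^ 4), by positivity, fun s t ht hs hts => ?_⟩
  rcases ht.eq_or_lt with rfl | ht
  · rw [logModulus_zero hM]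
    have := logModulus_nonneg M s
    positivity
  have hs0 : 0 < s := by
    by_contra! h
    rw [Real.sqrt_eq_zero_of_nonpos h] at hts
    linarith
  have hs1 : Real.log s < 0 := Real.log_neg hs0 (by linarith [hs.trans (min_le_left _ _)])
  have h1 : Real.log s ≤ 4 * -Real.log A := by
    have := Real.log_le_log hs0 (hs.trans (min_le_right _ _))
    rwa [Real.log_pow, Real.log_inv] at this
  have h2 : Real.log t ≤ Real.log A + Real.log s / 2 := by
    have := Real.log_le_log ht hts
    rwa [Real.log_mul hA.ne' (Real.sqrt_pos.2 hs0).ne', Real.log_sqrt hs0.le] at this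
  have h3 : |Real.log s| ≤ 4 * |Real.log t| := by
    rw [abs_of_neg hs1, abs_of_neg (by linarith)]
    linarith
  have h4 : 0 < |Real.log s| := abs_pos.2 hs1.ne
  have h5 : 0 < |Real.log t| := by linarith
  have h6 : |Real.log s| ^ M ≤ 4 ^ M * |Real.log t| ^ M := by
    rw [← Real.mul_rpow (by norm_num) h5.le]
    exact Real.rpow_le_rpow h4.le h3 hM.le
  unfold logModulus
  rw [mul_one_div, div_le_div_iff₀ (by positivity) (by positivity), one_mul]
  exact h6

theorem logModulus_le_of_le_mul {M A : ℝ} (hM : 0 < M) (hA : 0 < A) :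
    ∃ s₀ > 0, ∀ s t, 0 ≤ t → s ≤ s₀ → t ≤ A * s →
      logModulus M t ≤ 4 ^ M * logModulus M s := by
  obtain ⟨s₀, h0, h⟩ := logModulus_le_of_le_sqrt hM hA
  refine ⟨min s₀ 1, by positivity, fun s t ht hs hts =>
    h s t ht (hs.trans (min_le_left _ _)) (hts.trans ?_)⟩
  have hs' : 0 ≤ s := nonneg_of_mul_nonneg_right (ht.trans hts) hA
  gcongr
  exact Real.le_sqrt_of_sq_le (by nlinarith [hs.trans (min_le_right _ _)])

/-- `F` is `log^M`-continuous in a neighbourhood of the point `w`. -/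
def LogContinuousNear {E : Type*} [PseudoMetricSpace E] (M : ℝ) (F : E → ℝ) (w : E) : Prop :=
  ∃ C : ℝ, 0 ≤ C ∧ ∃ s ∈ 𝓝 w, ∀ y ∈ s, ∀ z ∈ s, |F y - F z| ≤ C * logModulus M (dist y z)

theorem LogContinuousNear.congr {E : Type*} [PseudoMetricSpace E] {M : ℝ} {F G : E → ℝ} {w : E}
    (hF : LogContinuousNear M F w) (h : F =ᶠ[𝓝 w] G) : LogContinuousNear M G w := by
  obtain ⟨C, hC, s, hs, H⟩ := hF
  refine ⟨C, hC, _, inter_mem hs h, ?_⟩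
  rintro y ⟨hy, hy'⟩ z ⟨hz, hz'⟩
  simp only [Set.mem_ofPred_eq] at hy' hz'
  rw [← hy', ← hz']
  exact H y hy z hz

theorem LogContinuousNear.comp_of_contDiffAt {𝕜 E E' : Type*} [RCLike 𝕜]
    [NormedAddCommGroup E] [NormedSpace 𝕜 E] [NormedAddCommGroup E'] [NormedSpace 𝕜 E']
    {M : ℝ} (hM : 0 < M) {F : E' → ℝ} {h : E → E'} {w : E}
    (hF : LogContinuousNear M F (h w)) (hh : ContDiffAt 𝕜 1 h w) :
    LogContinuousNear M (F ∘ h) w := by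
  obtain ⟨C, hC, s, hs, H⟩ := hF
  obtain ⟨K, t, ht, hK⟩ := hh.exists_lipschitzOnWith
  obtain ⟨s₀, hs₀, hmod⟩ := logModulus_le_of_le_mul hM (show (0 : ℝ) < K + 1 by positivity)
  refine ⟨C * 4 ^ M, by positivity, _, inter_mem (inter_mem ht
    (hh.continuousAt.preimage_mem_nhds hs)) (ball_mem_nhds w (half_pos hs₀)), ?_⟩
  rintro y ⟨⟨hy, hy'⟩, hy''⟩ z ⟨⟨hz, hz'⟩, hz''⟩
  refine (H _ hy' _ hz').trans ?_
  rw [mul_assoc]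
  refine mul_le_mul_of_nonneg_left (hmod _ _ dist_nonneg ?_ ?_) hC
  · have := dist_triangle_right y z w
    rw [mem_ball] at hy'' hz''
    linarith
  · refine (hK.dist_le_mul y hy z hz).trans ?_
    gcongr
    linarith

/-- `log^M`-continuity near every point of a compact set holds with uniform constants, even when
only one of the two points is required to lie in the set. -/
theorem exists_uniform_of_logContinuousNear {E : Type*} [PseudoMetricSpace E] {M : ℝ} {F : E → ℝ}
    {K : Set E} (hK : IsCompact K) (hF : ∀ w ∈ K, LogContinuousNear M F w) :
    ∃ C : ℝ, 0 ≤ C ∧ ∃ r > 0, ∀ y ∈ K, ∀ z, dist y z < r →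
      |F y - F z| ≤ C * logModulus M (dist y z) := by
  refine hK.induction_on (p := fun K => ∃ C : ℝ, 0 ≤ C ∧ ∃ r > 0, ∀ y ∈ K, ∀ z, dist y z < r →
      |F y - F z| ≤ C * logModulus M (dist y z)) ?_ ?_ ?_ ?_
  · exact ⟨0, le_rfl, 1, one_pos, by simp⟩
  · rintro s t hst ⟨C, hC, r, hr, H⟩
    exact ⟨C, hC, r, hr, fun y hy => H y (hst hy)⟩
  · rintro s t ⟨C, hC, r, hr, H⟩ ⟨C', hC', r', hr', H'⟩
    refine ⟨C + C', by positivity, min r r', lt_min hr hr', ?_⟩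
    rintro y (hy | hy) z hyz
    · refine (H y hy z (hyz.trans_le (min_le_left _ _))).trans ?_
      exact mul_le_mul_of_nonneg_right (by linarith) (logModulus_nonneg _ _)
    · refine (H' y hy z (hyz.trans_le (min_le_right _ _))).trans ?_
      exact mul_le_mul_of_nonneg_right (by linarith) (logModulus_nonneg _ _)
  · intro w hw
    obtain ⟨C, hC, s, hs, H⟩ := hF w hw
    obtain ⟨r, hr, hrs⟩ := Metric.mem_nhds_iff.1 hs
    refine ⟨ball w (r / 2), mem_nhdsWithin_of_mem_nhds (ball_mem_nhds w (half_pos hr)),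
      C, hC, r / 2, half_pos hr, fun y hy z hyz => ?_⟩
    rw [mem_ball] at hy
    refine H y (hrs ?_) z (hrs ?_)
    · rw [mem_ball]; linarith
    · rw [mem_ball]
      linarith [dist_triangle_left z w y]

end Modulus

/-! ### The model blow-up in affine coordinates -/

section Model

open Metric Filter Topology

variable {n : ℕ}

theorem norm_le_of_forall_norm_apply_le {a b : Cn n} (h : ∀ s, ‖a s‖ ≤ ‖b s‖) : ‖a‖ ≤ ‖b‖ := by
  rw [EuclideanSpace.norm_eq, EuclideanSpace.norm_eq]
  gcongr with s
  exact h s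

theorem norm_le_card_mul {a : Cn n} {b : ℝ} (h : ∀ s, ‖a s‖ ≤ b) : ‖a‖ ≤ n * b := by
  rcases Nat.eq_zero_or_pos n with rfl | hn
  · simp [EuclideanSpace.norm_eq]
  have hb : 0 ≤ b := (norm_nonneg _).trans (h ⟨0, hn⟩)
  rw [EuclideanSpace.norm_eq]
  refine Real.sqrt_le_iff.2 ⟨by positivity, ?_⟩
  have h1 : (1 : ℝ) ≤ n := by exact_mod_cast hn
  calc ∑ s, ‖a s‖ ^ 2 ≤ ∑ _s : Fin n, b ^ 2 := by gcongr with s; exact h s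
    _ = n * b ^ 2 := by simp
    _ ≤ (n * b) ^ 2 := by nlinarith [sq_nonneg b]

/-- The blow-down map of the model in the standard affine coordinates of index `i`: the
coordinates `w_s`, `s ∈ S \ {i}`, are multiplied by `w_i`. -/
noncomputable def modelBlowDown (S : Finset (Fin n)) (i : Fin n) (w : Cn n) : Cn n :=
  WithLp.toLp 2 fun s => if s ∈ S ∧ s ≠ i then w i * w s else w s

/-- The point with `i`-th affine coordinate `a`, directional coordinates `x_s / x_i`, and the
remaining coordinates of `x`. For `a = x_i ≠ 0` it is the unique point over `x` in this chart; for
`a = 0` it lies on the exceptional divisor, over the projection of `x` to the center. If `x_i = 0`,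
all directional coordinates are `0`. -/
noncomputable def modelLift (S : Finset (Fin n)) (i : Fin n) (a : ℂ) (x : Cn n) : Cn n :=
  WithLp.toLp 2 fun s => if s ∈ S then (if s = i then a else x s / x i) else x s

/-- The projection of `ℂⁿ` onto the linear subspace `{x_s = 0, s ∈ S}`. -/
noncomputable def centerProj (S : Finset (Fin n)) (x : Cn n) : Cn n :=
  WithLp.toLp 2 fun s => if s ∈ S then 0 else x s

theorem continuous_modelBlowDown (S : Finset (Fin n)) (i : Fin n) :
    Continuous (modelBlowDown S i) := by
  unfold modelBlowDown
  refine (PiLp.continuous_toLp 2 _).comp (continuous_pi fun s => ?_)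
  split_ifs <;> fun_prop

theorem modelBlowDown_modelLift_self {S : Finset (Fin n)} {i : Fin n} (hi : i ∈ S) {x : Cn n}
    (hx : x i = 0 → ∀ s ∈ S, x s = 0) : modelBlowDown S i (modelLift S i (x i) x) = x := by
  ext s
  simp only [modelBlowDown, modelLift, hi, if_true]
  by_cases hs : s ∈ S
  · by_cases hsi : s = i
    · simp [hsi, hi]
    · simp only [hs, hsi, ne_eq, not_false_eq_true, and_self, if_true, if_false]
      by_cases h0 : x i = 0
      · simp [h0, hx h0 s hs]
      · field_simp
  · simp [hs]

theorem modelBlowDown_modelLift_zero {S : Finset (Fin n)} {i : Fin n} (hi : i ∈ S) (x : Cn n) :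
    modelBlowDown S i (modelLift S i 0 x) = centerProj S x := by
  ext s
  simp only [modelBlowDown, modelLift, centerProj, hi, if_true]
  by_cases hs : s ∈ S
  · by_cases hsi : s = i
    · simp [hsi, hi]
    · simp [hs, hsi]
  · simp [hs]

/-- The bound on the directional coordinates makes up for the blow-down map not being proper on a
single affine chart. Every direction satisfies it in the chart of its largest coordinate. -/
theorem isCompact_modelBlowDown_preimage (S : Finset (Fin n)) (i : Fin n) (c : Cn n) (ρ : ℝ) :
    IsCompact {w : Cn n | modelBlowDown S i w ∈ closedBall c ρ ∧
      ∀ s ∈ S, s ≠ i → ‖w s‖ ≤ 1} := by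
  refine Metric.isCompact_of_isClosed_isBounded ?_ ?_
  · have h : IsClosed (modelBlowDown S i ⁻¹' closedBall c ρ ∩
        ⋂ s : Fin n, {w : Cn n | s ∈ S → s ≠ i → ‖w s‖ ≤ 1}) := by
      refine (isClosed_closedBall.preimage (continuous_modelBlowDown S i)).inter
        (isClosed_iInter fun s => ?_)
      by_cases hs : s ∈ S ∧ s ≠ i
      · simp only [hs.1, hs.2, ne_eq, not_false_eq_true, true_imp_iff]
        have : Continuous fun w : Cn n => ‖w s‖ := by fun_prop
        exact isClosed_Iic.preimage this
      · have : {w : Cn n | s ∈ S → s ≠ i → ‖w s‖ ≤ 1} = Set.univ := by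
          ext w
          simp only [Set.mem_ofPred_eq, Set.mem_univ, iff_true]
          exact fun h1 h2 => (hs ⟨h1, h2⟩).elim
        rw [this]
        exact isClosed_univ
    refine Eq.subst (motive := IsClosed) ?_ h
    ext w
    simp
  · refine (isBounded_iff_forall_norm_le).2 ⟨n * (1 + (‖c‖ + ρ)), fun w hw => ?_⟩
    refine norm_le_card_mul fun s => ?_
    have hρ : 0 ≤ ρ := dist_nonneg.trans hw.1
    by_cases hs : s ∈ S ∧ s ≠ i
    · have := hw.2 s hs.1 hs.2
      have := norm_nonneg c
      linarith
    · have h1 : modelBlowDown S i w s = w s := by simp [modelBlowDown, hs]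
      have h2 : ‖modelBlowDown S i w‖ ≤ ‖c‖ + ρ := by
        have := norm_le_norm_add_norm_sub' (modelBlowDown S i w) c
        have h3 := hw.1
        rw [mem_closedBall, dist_eq_norm] at h3
        linarith
      have := PiLp.norm_apply_le (modelBlowDown S i w) s
      rw [h1] at this
      linarith

theorem modelLift_apply_self {S : Finset (Fin n)} {i : Fin n} (hi : i ∈ S) (a : ℂ) (x : Cn n) :
    modelLift S i a x i = a := by
  simp [modelLift, hi]

theorem modelLift_apply_of_ne {S : Finset (Fin n)} {i s : Fin n} (hs : s ∈ S) (hsi : s ≠ i)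
    (a : ℂ) (x : Cn n) : modelLift S i a x s = x s / x i := by
  simp [modelLift, hs, hsi]

theorem modelLift_apply_of_notMem {S : Finset (Fin n)} {s : Fin n} (hs : s ∉ S) (i : Fin n)
    (a : ℂ) (x : Cn n) : modelLift S i a x s = x s := by
  simp [modelLift, hs]

theorem norm_modelLift_apply_le_one {S : Finset (Fin n)} {i : Fin n} {x : Cn n}
    (hx : ∀ s ∈ S, ‖x s‖ ≤ ‖x i‖) (a : ℂ) {s : Fin n} (hs : s ∈ S) (hsi : s ≠ i) :
    ‖modelLift S i a x s‖ ≤ 1 := by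
  rw [modelLift_apply_of_ne hs hsi, norm_div]
  exact div_le_one_of_le₀ (hx s hs) (norm_nonneg _)

/-- The directional coordinates of two points at distance at most `δ` differ by at most `4√δ` if one
of the points has distance at least `√δ` from the center (the denominator `c` is its largest
coordinate). -/
theorem norm_div_sub_div_le {a b c d : ℂ} {δ : ℝ} (hδ : 0 < δ) (hδ' : δ ≤ 1 / 4)
    (hac : ‖a‖ ≤ ‖c‖) (hab : ‖a - b‖ ≤ δ) (hcd : ‖c - d‖ ≤ δ) (hc : √δ ≤ ‖c‖) :
    ‖a / c - b / d‖ ≤ 4 * √δ := by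
  have hs : 0 < √δ := Real.sqrt_pos.2 hδ
  have hss : √δ * √δ = δ := Real.mul_self_sqrt hδ.le
  have hs2 : √δ ≤ 1 / 2 := by
    rw [Real.sqrt_le_left (by norm_num)]
    linarith
  have hc0 : 0 < ‖c‖ := hs.trans_le hc
  have hd : ‖c‖ / 2 ≤ ‖d‖ := by
    have := norm_sub_norm_le c d
    nlinarith
  have hd0 : 0 < ‖d‖ := by linarith
  have hc' : c ≠ 0 := norm_pos_iff.1 hc0
  have hd' : d ≠ 0 := norm_pos_iff.1 hd0
  have key : a / c - b / d = (a * (d - c) + c * (a - b)) / (c * d) := by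
    field_simp
    ring
  rw [key, norm_div, norm_mul, div_le_iff₀ (by positivity)]
  calc ‖a * (d - c) + c * (a - b)‖ ≤ ‖a‖ * ‖d - c‖ + ‖c‖ * ‖a - b‖ := by
        rw [← norm_mul, ← norm_mul]
        exact norm_add_le _ _
    _ ≤ ‖c‖ * δ + ‖c‖ * δ := by
        rw [norm_sub_rev d c]
        gcongr
    _ = 4 * √δ * (√δ * ‖c‖ / 2) := by
        linear_combination -(2 * ‖c‖) * hss
    _ ≤ 4 * √δ * (‖c‖ * ‖d‖) := by
        have : √δ * ‖c‖ / 2 ≤ ‖c‖ * ‖d‖ := by nlinarith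
        gcongr

/-- A function is `log^M`-continuous near a point of the center of the model blow-up if its
pull-backs to all the standard affine charts are `log^M`-continuous.

Two points `x`, `y` at distance `δ` are compared through lifts at distance `O(√δ)`. If one of them
has distance at least `√δ` from the center, the lifts in one affine chart are that close.
Otherwise one goes from `x` to its projection to the center in the direction of `x`, then along
the center in a fixed direction, and finally to `y` in the direction of `y`. -/
theorem logContinuousNear_of_modelBlowDown {M : ℝ} (hM : 0 < M) {S : Finset (Fin n)}
    (hS : S.Nonempty) {T : Set (Cn n)} (hT : IsOpen T) {c : Cn n} (hc : c ∈ T)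
    (hcS : ∀ s ∈ S, c s = 0) {F : Cn n → ℝ}
    (hF : ∀ i ∈ S, ∀ w, modelBlowDown S i w ∈ T →
      LogContinuousNear M (F ∘ modelBlowDown S i) w) :
    LogContinuousNear M F c := by
  obtain ⟨ρ, hρ, hρT⟩ := nhds_basis_closedBall.mem_iff.1 (hT.mem_nhds hc)
  choose! C hC r hr H using fun i (hi : i ∈ S) => exists_uniform_of_logContinuousNear
    (isCompact_modelBlowDown_preimage S i c ρ) (fun w hw => hF i hi w (hρT hw.1))
  obtain ⟨r₀, hr₀, hr₀r⟩ : ∃ r₀ > 0, ∀ i ∈ S, r₀ ≤ r i :=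
    ⟨S.inf' hS r, (Finset.lt_inf'_iff _).2 hr, fun i hi => Finset.inf'_le _ hi⟩
  obtain ⟨C₀, hC₀, hC₀C⟩ : ∃ C₀, 0 ≤ C₀ ∧ ∀ i ∈ S, C i ≤ C₀ :=
    ⟨∑ i ∈ S, C i, Finset.sum_nonneg hC, fun i hi => Finset.single_le_sum hC hi⟩
  obtain ⟨s₀, hs₀, hmod⟩ := logModulus_le_of_le_sqrt hM (show (0 : ℝ) < n * 4 + 1 by positivity)
  -- points with lifts whose coordinates differ by `O(√δ)`
  obtain ⟨δ₀, hδ₀, hδ₀', key⟩ : ∃ δ₀ > 0, δ₀ ≤ 1 / 4 ∧ ∀ δ ≤ δ₀, 0 < δ → ∀ i ∈ S, ∀ w w' : Cn n,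
      modelBlowDown S i w ∈ closedBall c ρ → (∀ s ∈ S, s ≠ i → ‖w s‖ ≤ 1) →
      (∀ s, ‖w s - w' s‖ ≤ 4 * √δ) →
      |F (modelBlowDown S i w) - F (modelBlowDown S i w')| ≤
        C₀ * (4 ^ M * logModulus M δ) := by
    refine ⟨min (min (1 / 4) s₀) ((r₀ / (n * 4 + 2)) ^ 2), by positivity,
      (min_le_left _ _).trans (min_le_left _ _), ?_⟩
    intro δ hδ hδ0 i hi w w' hw hw1 hww
    have hsq : √δ ≤ r₀ / (n * 4 + 2) :=
      (Real.sqrt_le_left (by positivity)).2 (hδ.trans (min_le_right _ _))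
    have hsq0 : 0 < √δ := Real.sqrt_pos.2 hδ0
    have hd : dist w w' ≤ (n * 4 + 1) * √δ := by
      rw [dist_eq_norm]
      refine (norm_le_card_mul (b := 4 * √δ) fun s => by simpa using hww s).trans ?_
      nlinarith
    have hdr : dist w w' < r i := by
      refine (hd.trans_lt ?_).trans_le (hr₀r i hi)
      rw [le_div_iff₀ (by positivity)] at hsq
      nlinarith
    refine (H i hi w ⟨hw, hw1⟩ w' hdr).trans ?_
    exact mul_le_mul (hC₀C i hi) (hmod _ _ dist_nonneg
      (hδ.trans ((min_le_left _ _).trans (min_le_right _ _))) hd)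
      (logModulus_nonneg _ _) hC₀
  have hproj : ∀ x ∈ closedBall c ρ, centerProj S x ∈ closedBall c ρ := by
    intro x hx
    rw [mem_closedBall, dist_eq_norm] at hx ⊢
    refine (norm_le_of_forall_norm_apply_le fun s => ?_).trans hx
    by_cases hs : s ∈ S
    · simp [centerProj, hs, hcS s hs]
    · simp [centerProj, hs]
  -- from a point close to the center to its projection, in the direction of the point
  have hvert : ∀ δ ≤ δ₀, 0 < δ → ∀ x ∈ closedBall c ρ, (∀ s ∈ S, ‖x s‖ ≤ 4 * √δ) →
      |F x - F (centerProj S x)| ≤ C₀ * (4 ^ M * logModulus M δ) := by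
    intro δ hδ hδ0 x hx hxδ
    obtain ⟨i, hi, hmax⟩ := S.exists_max_image (fun s => ‖x s‖) hS
    have h1 : modelBlowDown S i (modelLift S i (x i) x) = x :=
      modelBlowDown_modelLift_self hi fun h0 s hs => by simpa [h0] using hmax s hs
    have := key δ hδ hδ0 i hi (modelLift S i (x i) x) (modelLift S i 0 x) (by rwa [h1])
      (fun s hs hsi => norm_modelLift_apply_le_one hmax _ hs hsi) fun s => ?_
    · rwa [h1, modelBlowDown_modelLift_zero hi] at this
    · by_cases hsi : s = i
      · subst hsi
        rw [modelLift_apply_self hi, modelLift_apply_self hi, sub_zero]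
        exact hxδ s hi
      · by_cases hs : s ∈ S
        · rw [modelLift_apply_of_ne hs hsi, modelLift_apply_of_ne hs hsi, sub_self, norm_zero]
          positivity
        · rw [modelLift_apply_of_notMem hs, modelLift_apply_of_notMem hs, sub_self, norm_zero]
          positivity
  have hcp : ∀ x : Cn n, ∀ s ∈ S, centerProj S x s = 0 := fun x s hs => by simp [centerProj, hs]
  have hcp' : ∀ x : Cn n, ∀ s, s ∉ S → centerProj S x s = x s := fun x s hs => by
    simp [centerProj, hs]
  have hcc : ∀ x : Cn n, centerProj S (centerProj S x) = centerProj S x := by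
    intro x
    ext s
    by_cases hs : s ∈ S
    · rw [hcp _ s hs, hcp _ s hs]
    · rw [hcp' _ s hs]
  refine ⟨3 * (C₀ * 4 ^ M), by positivity, ball c (min ρ (δ₀ / 2)), ball_mem_nhds _ (by positivity),
    fun x hx y hy => ?_⟩
  rw [mem_ball, lt_min_iff] at hx hy
  have hxρ : x ∈ closedBall c ρ := hx.1.le
  have hyρ : y ∈ closedBall c ρ := hy.1.le
  rcases eq_or_ne x y with rfl | hxy
  · simp [logModulus_zero hM]
  set δ := dist x y with hδdef
  have hδ0 : 0 < δ := dist_pos.2 hxy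
  have hδ : δ ≤ δ₀ := by
    have := dist_triangle_right x y c
    linarith
  have hcoord : ∀ s, ‖x s - y s‖ ≤ δ := fun s => by
    rw [hδdef, dist_eq_norm]
    exact PiLp.norm_apply_le (x - y) s
  have hss : √δ * √δ = δ := Real.mul_self_sqrt hδ0.le
  have hs0 : 0 < √δ := Real.sqrt_pos.2 hδ0
  have hs2 : √δ ≤ 1 / 2 := by
    rw [Real.sqrt_le_left (by norm_num)]
    linarith
  have hδs : δ ≤ √δ := by nlinarith
  have hω : 0 ≤ C₀ * (4 ^ M * logModulus M δ) := by
    have := logModulus_nonneg M δ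
    positivity
  obtain ⟨i, hi, hmax⟩ := S.exists_max_image (fun s => ‖x s‖) hS
  -- `‖x i‖` is comparable to the distance of `x` from the center
  rcases le_or_gt (√δ) ‖x i‖ with hbig | hsmall
  · have h1 : modelBlowDown S i (modelLift S i (x i) x) = x :=
      modelBlowDown_modelLift_self hi fun h0 s hs => by simpa [h0] using hmax s hs
    have hyi : y i ≠ 0 := by
      intro h0
      have := hcoord i
      rw [h0, sub_zero] at this
      nlinarith
    have h2 : modelBlowDown S i (modelLift S i (y i) y) = y :=
      modelBlowDown_modelLift_self hi fun h0 => (hyi h0).elim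
    have := key δ hδ hδ0 i hi (modelLift S i (x i) x) (modelLift S i (y i) y) (by rwa [h1])
      (fun s hs hsi => norm_modelLift_apply_le_one hmax _ hs hsi) fun s => ?_
    · rw [h1, h2] at this
      linarith
    · by_cases hsi : s = i
      · subst hsi
        rw [modelLift_apply_self hi, modelLift_apply_self hi]
        linarith [hcoord s]
      · by_cases hs : s ∈ S
        · rw [modelLift_apply_of_ne hs hsi, modelLift_apply_of_ne hs hsi]
          exact norm_div_sub_div_le hδ0 (hδ.trans hδ₀') (hmax s hs) (hcoord s) (hcoord i) hbig
        · rw [modelLift_apply_of_notMem hs, modelLift_apply_of_notMem hs]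
          linarith [hcoord s]
  · have hxs : ∀ s ∈ S, ‖x s‖ ≤ √δ := fun s hs => (hmax s hs).trans hsmall.le
    have h1 := hvert δ hδ hδ0 x hxρ fun s hs => by linarith [hxs s hs]
    have h2 := hvert δ hδ hδ0 y hyρ fun s hs => by
      have h3 := norm_sub_norm_le (y s) (x s)
      rw [norm_sub_rev] at h3
      linarith [hxs s hs, hcoord s]
    -- along the center, in a direction independent of the point
    have h3 : |F (centerProj S x) - F (centerProj S y)| ≤ C₀ * (4 ^ M * logModulus M δ) := by
      have := key δ hδ hδ0 i hi (modelLift S i 0 (centerProj S x))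
        (modelLift S i 0 (centerProj S y))
        (by rw [modelBlowDown_modelLift_zero hi, hcc]; exact hproj x hxρ)
        (fun s hs hsi => by rw [modelLift_apply_of_ne hs hsi, hcp x s hs]; simp) fun s => ?_
      · rwa [modelBlowDown_modelLift_zero hi, modelBlowDown_modelLift_zero hi, hcc, hcc] at this
      · by_cases hsi : s = i
        · subst hsi
          rw [modelLift_apply_self hi, modelLift_apply_self hi, sub_self, norm_zero]
          positivity
        · by_cases hs : s ∈ S
          · rw [modelLift_apply_of_ne hs hsi, modelLift_apply_of_ne hs hsi, hcp x s hs,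
              hcp y s hs, zero_div, zero_div, sub_self, norm_zero]
            positivity
          · rw [modelLift_apply_of_notMem hs, modelLift_apply_of_notMem hs, hcp' x s hs,
              hcp' y s hs]
            linarith [hcoord s]
    rw [abs_le] at h1 h2 h3 ⊢
    constructor <;> linarith [h1.1, h1.2, h2.1, h2.2, h3.1, h3.2]

end Model

/-! ### Descent along a blow-up -/

section BlowDown

open Filter Topology

variable {n : ℕ}

/-- `u` is locally `log^M`-continuous with respect to the Euclidean distance in every holomorphic
chart of `X`. -/
def LogContinuousInCharts (n : ℕ) {X : Type*} [TopologicalSpace X] [ChartedSpace (Cn n) X]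
    (M : ℝ) (u : X → ℝ) : Prop :=
  ∀ φ ∈ IsManifold.maximalAtlas 𝓘(ℂ, Cn n) ω X, ∀ w ∈ φ.target,
    LogContinuousNear M (u ∘ φ.symm) w

variable {X Y : Type*} [TopologicalSpace X] [ChartedSpace (Cn n) X]
  [TopologicalSpace Y] [ChartedSpace (Cn n) Y]

theorem logContinuousInCharts_of_forall_exists_chart [IsManifold 𝓘(ℂ, Cn n) ω X]
    {M : ℝ} (hM : 0 < M) {u : X → ℝ}
    (h : ∀ ξ : X, ∃ φ ∈ IsManifold.maximalAtlas 𝓘(ℂ, Cn n) ω X, ξ ∈ φ.source ∧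
      LogContinuousNear M (u ∘ φ.symm) (φ ξ)) :
    LogContinuousInCharts n M u := by
  intro ψ hψ w hw
  obtain ⟨φ, hφ, hξ, H⟩ := h (ψ.symm w)
  have hd : ContDiffAt ℂ 1 (φ ∘ ψ.symm) w := by
    rw [← contMDiffAt_iff_contDiffAt]
    refine ContMDiffAt.comp w (I' := 𝓘(ℂ, Cn n)) ?_ ?_
    · exact (contMDiffAt_of_mem_maximalAtlas hφ hξ).of_le (by simp)
    · exact (contMDiffAt_symm_of_mem_maximalAtlas hψ hw).of_le (by simp)
  refine (LogContinuousNear.comp_of_contDiffAt (h := φ ∘ ψ.symm) hM H hd).congr ?_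
  have : ψ.symm ⁻¹' φ.source ∈ 𝓝 w :=
    (ψ.continuousAt_symm hw).preimage_mem_nhds (φ.open_source.mem_nhds hξ)
  filter_upwards [this] with z hz
  simp [φ.left_inv hz]

/-- In the affine coordinates `w = modelCoord i p`, the blow-down map is `modelBlowDown`. -/
theorem modelBlowDown_modelCoord {S : Finset (Fin n)} (i : S)
    {p : Cn n × Projectivization ℂ (S → ℂ)} (hp : p ∈ modelBlowUp S) (hi : p.2.rep i ≠ 0) :
    modelBlowDown S i (modelCoord i p) = p.1 := by
  ext s
  by_cases hs : s ∈ S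
  · by_cases hsi : s = i
    · subst hsi
      simp [modelBlowDown, modelCoord, hs]
    · have := hp ⟨s, hs⟩ i
      simp only [modelBlowDown, modelCoord, hs, hsi, ne_eq, not_false_eq_true, and_self, if_true,
        dite_true, if_false, i.2]
      field_simp
      rw [mul_comm (p.2.rep i)]
      exact this.symm
  · simp [modelBlowDown, modelCoord, hs]

/-- Every point of `ℂⁿ` is the `i`-th affine coordinate vector of a point of the model blow-up. -/
theorem exists_modelCoord_eq {S : Finset (Fin n)} (i : S) (w : Cn n) :
    ∃ P : Projectivization ℂ (S → ℂ), (modelBlowDown S i w, P) ∈ modelBlowUp S ∧ P.rep i ≠ 0 ∧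
      modelCoord i (modelBlowDown S i w, P) = w := by
  classical
  set v : S → ℂ := fun s => if s = i then 1 else w s with hv
  have hvi : v i = 1 := by simp [hv]
  have hv0 : v ≠ 0 := fun h => by simp [h] at hvi
  obtain ⟨a, ha⟩ := Projectivization.exists_smul_eq_mk_rep ℂ v hv0
  have hrep : ∀ s, (Projectivization.mk ℂ v hv0).rep s = (a : ℂ) * v s := fun s => by
    rw [← ha]; rfl
  have ha0 : (a : ℂ) ≠ 0 := a.ne_zero
  have hb : ∀ s : S, modelBlowDown S i w s = w i * v s := fun s => by
    by_cases hs : s = i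
    · subst hs; simp [modelBlowDown, hv]
    · have : (s : Fin n) ≠ i := fun h => hs (Subtype.ext h)
      simp [modelBlowDown, hv, hs, this]
  refine ⟨Projectivization.mk ℂ v hv0, fun s t => ?_, ?_, ?_⟩
  · simp only [hrep, hb]; ring
  · rw [hrep, hvi]; simp
  · ext s
    by_cases hs : s ∈ S
    · by_cases hsi : s = i
      · subst hsi; simp [modelCoord, modelBlowDown]
      · have : (⟨s, hs⟩ : S) ≠ i := fun h => hsi (congrArg Subtype.val h)
        simp only [modelCoord, hs, hsi, dite_true, if_false, hrep, hvi, mul_one]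
        rw [mul_div_cancel_left₀ _ ha0]
        simp [hv, this]
    · simp [modelCoord, modelBlowDown, hs]

/-- If `f` is the model blow-up over the chart `φ`, then in the affine chart of index `i` of `Y`
the function `u ∘ f` is `u ∘ φ⁻¹` composed with the model blow-down map; the target of that affine
chart contains the whole preimage of `φ.target` under the model blow-down map. -/
theorem IsModelBlowUpOver.logContinuousNear_comp_modelBlowDown {Z : Type*} [TopologicalSpace Z]
    {M : ℝ} {f : Y → Z} {u : Z → ℝ} (hu : LogContinuousInCharts n M (u ∘ f)) {S : Finset (Fin n)}
    {φ : OpenPartialHomeomorph Z (Cn n)} (h : IsModelBlowUpOver f S φ) {i : Fin n} (hi : i ∈ S)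
    {w : Cn n} (hw : modelBlowDown S i w ∈ φ.target) :
    LogContinuousNear M ((u ∘ φ.symm) ∘ modelBlowDown S i) w := by
  obtain ⟨q, hq, hψ⟩ := h
  obtain ⟨ψ, hψA, hψs, hψc⟩ := hψ ⟨i, hi⟩
  obtain ⟨P, hP, hPi, hPw⟩ := exists_modelCoord_eq ⟨i, hi⟩ w
  obtain ⟨y, hy, hyP⟩ := hq.surjOn ⟨hP, hw⟩
  simp only [Prod.mk.injEq] at hyP
  have hys : y ∈ ψ.source := by
    rw [hψs]
    exact ⟨hy, by rw [hyP.2]; exact hPi⟩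
  have hwt : w ∈ ψ.target := by
    have : ψ y = w := by rw [hψc y hys, hyP.1, hyP.2, hPw]
    exact this ▸ ψ.map_source hys
  refine (hu ψ hψA w hwt).congr ?_
  filter_upwards [ψ.open_target.mem_nhds hwt] with z hz
  have hs := ψ.map_target hz
  have hs' := hs
  rw [hψs] at hs'
  have h1 : modelBlowDown S i z = φ (f (ψ.symm z)) := by
    conv_lhs => rw [← ψ.right_inv hz, hψc _ hs]
    exact modelBlowDown_modelCoord ⟨i, hi⟩ (hq.mapsTo hs'.1).1 hs'.2
  simp only [Function.comp_apply]
  rw [h1, φ.left_inv hs'.1]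

/-- Local `log^M`-continuity descends along a blow-up: outside the center the blow-down map has a
local holomorphic section, and at the center the model case applies. -/
theorem IsBlowUp.logContinuousInCharts [IsManifold 𝓘(ℂ, Cn n) ω X] [IsManifold 𝓘(ℂ, Cn n) ω Y]
    {M : ℝ} (hM : 0 < M) {V : Set X} {f : Y → X} (hf : IsBlowUp (n := n) V f) {u : X → ℝ}
    (hu : LogContinuousInCharts n M (u ∘ f)) : LogContinuousInCharts n M u := by
  refine logContinuousInCharts_of_forall_exists_chart hM fun ξ => ?_
  by_cases hξ : ξ ∈ V
  · obtain ⟨S, φ, hS, hξφ, hφ, hmod⟩ := hf.local_model ξ hξ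
    refine ⟨φ, hφ.1, hξφ, ?_⟩
    exact logContinuousNear_of_modelBlowDown hM hS φ.open_target (φ.map_source hξφ)
      ((hφ.2 ξ hξφ).1 hξ) fun i hi w hw => hmod.logContinuousNear_comp_modelBlowDown hu hi hw
  · obtain ⟨h, hh, hfh, -⟩ := hf.biholomorphic_compl
    have hV : Vᶜ ∈ 𝓝 ξ := hf.isClosed.isOpen_compl.mem_nhds hξ
    set φ := chartAt (Cn n) ξ
    set ψ := chartAt (Cn n) (h ξ)
    have hφ : φ ∈ IsManifold.maximalAtlas 𝓘(ℂ, Cn n) ω X := IsManifold.chart_mem_maximalAtlas ξ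
    have hψ : ψ ∈ IsManifold.maximalAtlas 𝓘(ℂ, Cn n) ω Y := IsManifold.chart_mem_maximalAtlas _
    have hξφ : ξ ∈ φ.source := mem_chart_source _ ξ
    have hξψ : h ξ ∈ ψ.source := mem_chart_source _ (h ξ)
    have hξt : φ ξ ∈ φ.target := φ.map_source hξφ
    have hinv : φ.symm (φ ξ) = ξ := φ.left_inv hξφ
    have hh' : ContMDiffAt 𝓘(ℂ, Cn n) 𝓘(ℂ, Cn n) ω h ξ := hh.contMDiffAt hV
    refine ⟨φ, hφ, hξφ, ?_⟩
    have hd : ContDiffAt ℂ 1 (ψ ∘ h ∘ φ.symm) (φ ξ) := by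
      rw [← contMDiffAt_iff_contDiffAt]
      refine ContMDiffAt.of_le (n := ω) ?_ (by simp)
      refine ContMDiffAt.comp (φ ξ) (I' := 𝓘(ℂ, Cn n)) ?_
        (ContMDiffAt.comp (φ ξ) (I' := 𝓘(ℂ, Cn n)) ?_
          (contMDiffAt_symm_of_mem_maximalAtlas hφ hξt))
      · refine contMDiffAt_of_mem_maximalAtlas hψ ?_
        simpa [hinv] using hξψ
      · rwa [hinv]
    have hloc := hu ψ hψ (ψ (h ξ)) (ψ.map_source hξψ)
    have hpt : (ψ ∘ h ∘ φ.symm) (φ ξ) = ψ (h ξ) := by simp [hinv]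
    rw [← hpt] at hloc
    refine (LogContinuousNear.comp_of_contDiffAt hM hloc hd).congr ?_
    have hc : ContinuousAt φ.symm (φ ξ) := φ.continuousAt_symm hξt
    have h1 : φ.symm ⁻¹' (Vᶜ ∩ h ⁻¹' ψ.source) ∈ 𝓝 (φ ξ) := by
      refine hc.preimage_mem_nhds ?_
      rw [hinv]
      exact inter_mem hV (hh'.continuousAt.preimage_mem_nhds (ψ.open_source.mem_nhds hξψ))
    filter_upwards [h1] with z hz
    simp only [Function.comp_apply]
    rw [ψ.left_inv hz.2, hfh _ hz.1]

end BlowDown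

/-! ### Independence of the metric on compact manifolds -/

section MetricEDist

open Filter Topology Manifold Bundle
open scoped NNReal

variable {n : ℕ} {X : Type*} [TopologicalSpace X] [ChartedSpace (Cn n) X]
  [IsManifold 𝓘(ℂ, Cn n) ω X] (g : SmoothMetric n X)

theorem isManifold_real_one (n : ℕ) (X : Type*) [TopologicalSpace X] [ChartedSpace (Cn n) X]
    [IsManifold 𝓘(ℂ, Cn n) ω X] : IsManifold 𝓘(ℝ, Cn n) 1 X :=
  IsManifold.of_le (n := ω) (by simp)

theorem isContinuousRiemannianBundle :
    letI : RiemannianBundle (fun x : X => TangentSpace 𝓘(ℝ, Cn n) x) := ⟨g.toRiemannianMetric⟩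
    IsContinuousRiemannianBundle (Cn n) (fun x : X => TangentSpace 𝓘(ℝ, Cn n) x) :=
  letI : RiemannianBundle (fun x : X => TangentSpace 𝓘(ℝ, Cn n) x) := ⟨g.toRiemannianMetric⟩
  ⟨g.inner, g.contMDiff.continuous, fun _ _ _ => rfl⟩

theorem metricEDist_comm (x y : X) : metricEDist g x y = metricEDist g y x :=
  letI : RiemannianBundle (fun x : X => TangentSpace 𝓘(ℝ, Cn n) x) := ⟨g.toRiemannianMetric⟩
  riemannianEDist_comm

theorem metricEDist_triangle (x y z : X) :
    metricEDist g x z ≤ metricEDist g x y + metricEDist g y z :=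
  letI : RiemannianBundle (fun x : X => TangentSpace 𝓘(ℝ, Cn n) x) := ⟨g.toRiemannianMetric⟩
  riemannianEDist_triangle

theorem eventually_metricEDist_lt (x : X) {c : ℝ≥0∞} (hc : 0 < c) :
    ∀ᶠ y in 𝓝 x, metricEDist g x y < c :=
  letI : RiemannianBundle (fun x : X => TangentSpace 𝓘(ℝ, Cn n) x) := ⟨g.toRiemannianMetric⟩
  haveI := isContinuousRiemannianBundle g
  haveI := isManifold_real_one n X
  eventually_riemannianEDist_lt 𝓘(ℝ, Cn n) x hc

theorem exists_metricEDist_lt_subset [RegularSpace X] {x : X} {s : Set X} (hs : s ∈ 𝓝 x) :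
    ∃ c > (0 : ℝ≥0), {y | metricEDist g x y < c} ⊆ s :=
  letI : RiemannianBundle (fun x : X => TangentSpace 𝓘(ℝ, Cn n) x) := ⟨g.toRiemannianMetric⟩
  haveI := isContinuousRiemannianBundle g
  haveI := isManifold_real_one n X
  setOfPred_riemannianEDist_lt_subset_nhds 𝓘(ℝ, Cn n) hs

theorem exists_metricEDist_le_dist_chartAt (x : X) :
    ∃ C > (0 : ℝ), ∃ s ∈ 𝓝 x, ∀ y ∈ s, ∀ z ∈ s,
      metricEDist g y z ≤ ENNReal.ofReal (C * dist (chartAt (Cn n) x y) (chartAt (Cn n) x z)) := by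
  let : RiemannianBundle (fun x : X => TangentSpace 𝓘(ℝ, Cn n) x) := ⟨g.toRiemannianMetric⟩
  have := isContinuousRiemannianBundle g
  have := isManifold_real_one n X
  obtain ⟨C, hC, s, hs, H⟩ :=
    exists_riemannianEDist_le_edist_extChartAt 𝓘(ℝ, Cn n) x
  refine ⟨C, by exact_mod_cast hC, s, hs, fun y hy z hz => ?_⟩
  rw [ENNReal.ofReal_mul C.coe_nonneg, ← edist_dist, ENNReal.ofReal_coe_nnreal]
  have h := H y hy z hz
  simp only [mfld_simps] at h
  exact h

theorem exists_edist_chartAt_le_metricEDist [RegularSpace X] (x : X) :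
    ∃ C > (0 : ℝ≥0), ∃ s ∈ 𝓝 x, ∀ y ∈ s, ∀ z ∈ s,
      edist (chartAt (Cn n) x y) (chartAt (Cn n) x z) ≤ C * metricEDist g y z := by
  let : RiemannianBundle (fun x : X => TangentSpace 𝓘(ℝ, Cn n) x) := ⟨g.toRiemannianMetric⟩
  have := isContinuousRiemannianBundle g
  have := isManifold_real_one n X
  obtain ⟨C, hC, s, hs, H⟩ :=
    exists_edist_extChartAt_le_riemannianEDist 𝓘(ℝ, Cn n) x
  refine ⟨C, hC, s, hs, fun y hy z hz => ?_⟩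
  have h := H y hy z hz
  simp only [mfld_simps] at h
  exact h

variable {g}

theorem LogContinuous.logContinuousInCharts {M : ℝ} (hM : 0 < M) {u : X → ℝ}
    (hu : LogContinuous g M u) : LogContinuousInCharts n M u := by
  refine logContinuousInCharts_of_forall_exists_chart hM fun ξ => ?_
  set φ := chartAt (Cn n) ξ with hφ
  have hξ : ξ ∈ φ.source := mem_chart_source _ ξ
  refine ⟨φ, IsManifold.chart_mem_maximalAtlas ξ, hξ, ?_⟩
  obtain ⟨C, hC, hu⟩ := hu
  obtain ⟨L, hL, s, hs, H⟩ := exists_metricEDist_le_dist_chartAt g ξ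
  obtain ⟨s₀, hs₀, hmod⟩ := logModulus_le_of_le_mul hM hL
  have hball : Metric.ball (φ ξ) (min (s₀ / 2) (1 / (4 * L))) ∈ 𝓝 (φ ξ) :=
    Metric.ball_mem_nhds _ (by positivity)
  have hpre : φ.symm ⁻¹' s ∈ 𝓝 (φ ξ) := by
    refine (φ.continuousAt_symm (φ.map_source hξ)).preimage_mem_nhds ?_
    rwa [φ.left_inv hξ]
  refine ⟨C * 4 ^ M, by positivity, _, inter_mem (inter_mem hball hpre)
    (φ.open_target.mem_nhds (φ.map_source hξ)), ?_⟩
  rintro y ⟨⟨hy, hys⟩, hyt⟩ z ⟨⟨hz, hzs⟩, hzt⟩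
  rw [Metric.mem_ball, lt_min_iff] at hy hz
  have hd := H _ hys _ hzs
  rw [← hφ, φ.right_inv hyt, φ.right_inv hzt] at hd
  have hyz := dist_triangle_right y z (φ ξ)
  have hlt : L * dist y z < 1 := by
    have : dist y z < 2 * (1 / (4 * L)) := by linarith
    calc L * dist y z < L * (2 * (1 / (4 * L))) := by gcongr
      _ = 1 / 2 := by field_simp; norm_num
      _ < 1 := by norm_num
  have hlt' : metricEDist g (φ.symm y) (φ.symm z) < 1 :=
    hd.trans_lt (ENNReal.ofReal_lt_one.2 hlt)
  have htop : metricEDist g (φ.symm y) (φ.symm z) ≠ ⊤ := (hlt'.trans ENNReal.one_lt_top).ne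
  refine (hu _ _ htop hlt'.ne).trans ?_
  rw [div_eq_mul_one_div, mul_assoc]
  refine mul_le_mul_of_nonneg_left (hmod _ _ ENNReal.toReal_nonneg ?_ ?_) hC.le
  · linarith
  · exact ENNReal.toReal_le_of_le_ofReal (by positivity) hd

/-- Local `log^M`-continuity on a compact manifold is uniform with respect to the distance of any
Riemannian metric. -/
theorem LogContinuousInCharts.exists_uniform [CompactSpace X] [RegularSpace X] {M : ℝ}
    (hM : 0 < M) {u : X → ℝ} (hu : LogContinuousInCharts n M u) (g : SmoothMetric n X) :
    ∃ C : ℝ, 0 ≤ C ∧ ∃ r : ℝ≥0, 0 < r ∧ ∀ x y, metricEDist g x y < r →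
      |u x - u y| ≤ C * logModulus M (metricEDist g x y).toReal := by
  have main := isCompact_univ.induction_on (X := X) (p := fun K => ∃ C : ℝ, 0 ≤ C ∧
    ∃ r : ℝ≥0, 0 < r ∧ ∀ x ∈ K, ∀ y, metricEDist g x y < r →
      |u x - u y| ≤ C * logModulus M (metricEDist g x y).toReal) ?_ ?_ ?_ ?_
  · obtain ⟨C, hC, r, hr, H⟩ := main
    exact ⟨C, hC, r, hr, fun x => H x (Set.mem_univ x)⟩
  · exact ⟨0, le_rfl, 1, one_pos, by simp⟩
  · rintro s t hst ⟨C, hC, r, hr, H⟩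
    exact ⟨C, hC, r, hr, fun y hy => H y (hst hy)⟩
  · rintro s t ⟨C, hC, r, hr, H⟩ ⟨C', hC', r', hr', H'⟩
    refine ⟨C + C', by positivity, min r r', lt_min hr hr', ?_⟩
    rintro y (hy | hy) z hyz
    · refine (H y hy z (hyz.trans_le (by exact_mod_cast min_le_left _ _))).trans ?_
      exact mul_le_mul_of_nonneg_right (by linarith) (logModulus_nonneg _ _)
    · refine (H' y hy z (hyz.trans_le (by exact_mod_cast min_le_right _ _))).trans ?_
      exact mul_le_mul_of_nonneg_right (by linarith) (logModulus_nonneg _ _)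
  · intro ξ _
    set φ := chartAt (Cn n) ξ
    have hξ : ξ ∈ φ.source := mem_chart_source _ ξ
    obtain ⟨C, hC, s, hs, H⟩ := hu φ (IsManifold.chart_mem_maximalAtlas ξ) _ (φ.map_source hξ)
    obtain ⟨L, hL, t, ht, hLt⟩ := exists_edist_chartAt_le_metricEDist g ξ
    obtain ⟨s₀, hs₀, hmod⟩ := logModulus_le_of_le_mul hM (show (0 : ℝ) < L from hL)
    obtain ⟨c, hc, hcs⟩ := exists_metricEDist_lt_subset g (inter_mem (inter_mem ht
      (φ.open_source.mem_nhds hξ)) ((φ.continuousAt hξ).preimage_mem_nhds hs))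
    have hc2 : (0 : ℝ≥0∞) < ((c / 2 : ℝ≥0) : ℝ≥0∞) := by
      rw [ENNReal.coe_pos]; positivity
    refine ⟨_, mem_nhdsWithin_of_mem_nhds (eventually_metricEDist_lt g ξ hc2),
      C * 4 ^ M, by positivity, min (c / 2) s₀.toNNReal, by positivity, fun x hx y hxy => ?_⟩
    have hxy1 : metricEDist g x y < ((c / 2 : ℝ≥0) : ℝ≥0∞) :=
      hxy.trans_le (by exact_mod_cast min_le_left _ _)
    have hxy2 : metricEDist g x y < ENNReal.ofReal s₀ :=
      hxy.trans_le (ENNReal.coe_le_coe.2 (min_le_right _ _))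
    have hcc : ((c / 2 : ℝ≥0) : ℝ≥0∞) + ((c / 2 : ℝ≥0) : ℝ≥0∞) = c := by
      rw [← ENNReal.coe_add, add_halves]
    obtain ⟨⟨hxt, hxφ⟩, hxs⟩ := hcs (show metricEDist g ξ x < c from
      lt_of_lt_of_le hx (hcc ▸ le_self_add))
    obtain ⟨⟨hyt, hyφ⟩, hys⟩ := hcs (show metricEDist g ξ y < c from
      (metricEDist_triangle g ξ x y).trans_lt (hcc ▸ ENNReal.add_lt_add hx hxy1))
    have h1 := H _ hxs _ hys
    simp only [Function.comp_apply, φ.left_inv hxφ, φ.left_inv hyφ] at h1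
    have htop : metricEDist g x y ≠ ⊤ := hxy2.ne_top
    refine h1.trans ?_
    rw [mul_assoc]
    refine mul_le_mul_of_nonneg_left (hmod _ _ dist_nonneg ?_ ?_) hC
    · exact ENNReal.toReal_le_of_le_ofReal hs₀.le hxy2.le
    · have h2 := ENNReal.toReal_mono (ENNReal.mul_ne_top ENNReal.coe_ne_top htop)
        (hLt x hxt y hyt)
      rwa [edist_dist, ENNReal.toReal_ofReal dist_nonneg, ENNReal.toReal_mul,
        ENNReal.coe_toReal] at h2

/-- On a compact manifold, the distances between points of the same component are bounded. -/
theorem exists_forall_metricEDist_toReal_le [CompactSpace X] (g : SmoothMetric n X) :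
    ∃ D : ℝ, ∀ x y, (metricEDist g x y).toReal ≤ D := by
  obtain ⟨t, -, ht⟩ := isCompact_univ.elim_nhds_subcover
    (fun x => {y | metricEDist g x y < 1}) fun x _ => eventually_metricEDist_lt g x one_pos
  refine ⟨2 + ∑ p ∈ t ×ˢ t, (metricEDist g p.1 p.2).toReal, fun x y => ?_⟩
  have hsum : 0 ≤ ∑ p ∈ t ×ˢ t, (metricEDist g p.1 p.2).toReal :=
    Finset.sum_nonneg fun _ _ => ENNReal.toReal_nonneg
  rcases eq_or_ne (metricEDist g x y) ⊤ with h | h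
  · rw [h]
    simp only [ENNReal.toReal_top]
    linarith
  have hx := ht (Set.mem_univ x)
  have hy := ht (Set.mem_univ y)
  simp only [Set.mem_iUnion, Set.mem_ofPred_eq, exists_prop] at hx hy
  obtain ⟨a, ha, hax⟩ := hx
  obtain ⟨b, hb, hby⟩ := hy
  have h1 := hax.ne_top
  have h2 := hby.ne_top
  have hab : metricEDist g a b ≠ ⊤ := by
    refine ne_top_of_le_ne_top ?_ ((metricEDist_triangle g a x b).trans
      (add_le_add_right (metricEDist_triangle g x y b) _))
    rw [metricEDist_comm g y b]
    simp [h1, h2, h]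
  have hle : metricEDist g x y ≤ metricEDist g a x + (metricEDist g a b + metricEDist g b y) := by
    refine (metricEDist_triangle g x a y).trans ?_
    rw [metricEDist_comm g x a]
    exact add_le_add_right (metricEDist_triangle g a b y) _
  have hle' := ENNReal.toReal_mono (by simp [h1, h2, hab]) hle
  rw [ENNReal.toReal_add h1 (by simp [h2, hab]), ENNReal.toReal_add hab h2] at hle'
  have h1' : (metricEDist g a x).toReal ≤ 1 := ENNReal.toReal_le_of_le_ofReal zero_le_one
    (by simpa using hax.le)
  have h2' : (metricEDist g b y).toReal ≤ 1 := ENNReal.toReal_le_of_le_ofReal zero_le_one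
    (by simpa using hby.le)
  have := Finset.single_le_sum (f := fun p : X × X => (metricEDist g p.1 p.2).toReal)
    (fun _ _ => ENNReal.toReal_nonneg) (Finset.mk_mem_product ha hb)
  simp only at this
  linarith

theorem LogContinuousInCharts.exists_abs_le [CompactSpace X] {M : ℝ}
    (hM : 0 < M) {u : X → ℝ} (hu : LogContinuousInCharts n M u) :
    ∃ B : ℝ, ∀ x, |u x| ≤ B := by
  have hloc : ∀ ξ : X, ∃ B : ℝ, ∀ᶠ x in 𝓝 ξ, |u x| ≤ B := by
    intro ξ
    set φ := chartAt (Cn n) ξ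
    have hξ : ξ ∈ φ.source := mem_chart_source _ ξ
    obtain ⟨C, hC, s, hs, H⟩ := hu φ (IsManifold.chart_mem_maximalAtlas ξ) _ (φ.map_source hξ)
    obtain ⟨s₀, hs₀, hmod⟩ := logModulus_le_of_le_mul hM one_pos
    refine ⟨|u ξ| + C * (4 ^ M * logModulus M s₀), ?_⟩
    filter_upwards [φ.open_source.mem_nhds hξ, (φ.continuousAt hξ).preimage_mem_nhds
      (inter_mem hs (Metric.ball_mem_nhds _ hs₀))] with x hx hxs
    have h1 := H _ hxs.1 _ (mem_of_mem_nhds hs)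
    simp only [Function.comp_apply, φ.left_inv hx, φ.left_inv hξ] at h1
    have h2 := hmod s₀ (dist (φ x) (φ ξ)) dist_nonneg le_rfl (by
      rw [one_mul]; exact le_of_lt hxs.2)
    have h3 := mul_le_mul_of_nonneg_left h2 hC
    have h4 := abs_sub_abs_le_abs_sub (u x) (u ξ)
    linarith
  choose B hB using hloc
  obtain ⟨t, -, ht⟩ := isCompact_univ.elim_nhds_subcover
    (fun ξ => {x | |u x| ≤ B ξ}) fun ξ _ => hB ξ
  refine ⟨∑ ξ ∈ t, |B ξ|, fun x => ?_⟩
  have hx := ht (Set.mem_univ x)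
  simp only [Set.mem_iUnion, Set.mem_ofPred_eq, exists_prop] at hx
  obtain ⟨ξ, hξ, hξx⟩ := hx
  exact (hξx.trans (le_abs_self _)).trans
    (Finset.single_le_sum (f := fun ξ => |B ξ|) (fun _ _ => abs_nonneg _) hξ)

/-- Points at small distance are covered by the uniform local estimate. All other finite distances
lie in a compact subinterval of `(0, ∞)`, where the modulus is bounded below (the distance `1` is
excluded), and `u` is bounded. -/
theorem LogContinuousInCharts.logContinuous [CompactSpace X] [RegularSpace X] {M : ℝ}
    (hM : 0 < M) {u : X → ℝ} (hu : LogContinuousInCharts n M u) (g : SmoothMetric n X) :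
    LogContinuous g M u := by
  obtain ⟨C, hC, r, hr, H⟩ := hu.exists_uniform hM g
  obtain ⟨B, hB⟩ := hu.exists_abs_le hM
  obtain ⟨D, hD⟩ := exists_forall_metricEDist_toReal_le g
  -- `Λ` bounds `|log d|` for all distances `d ≥ r`
  set Λ := |Real.log r| + |Real.log D| with hΛ
  refine ⟨C + 2 * |B| * Λ ^ M + 1, by positivity, fun x y htop h1 => ?_⟩
  rw [div_eq_mul_one_div]
  change _ ≤ _ * logModulus M _
  set d := (metricEDist g x y).toReal with hd
  have hω := logModulus_nonneg M d
  have hΛM : 0 ≤ Λ ^ M := by positivity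
  rcases lt_or_ge (metricEDist g x y) r with hlt | hge
  · refine (H x y hlt).trans (mul_le_mul_of_nonneg_right ?_ hω)
    have : 0 ≤ 2 * |B| * Λ ^ M := by positivity
    linarith
  · have hrd : (r : ℝ) ≤ d := by
      have := ENNReal.toReal_mono htop hge
      simpa using this
    have hr0 : (0 : ℝ) < r := hr
    have hd0 : 0 < d := hr0.trans_le hrd
    have hd1 : d ≠ 1 := by
      intro h
      rw [hd, ENNReal.toReal_eq_one_iff] at h
      exact h1 h
    have hlog0 : 0 < |Real.log d| := abs_pos.2 (Real.log_ne_zero_of_pos_of_ne_one hd0 hd1)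
    have hlog : |Real.log d| ≤ Λ := by
      have h2 := Real.log_le_log hr0 hrd
      have h3 := Real.log_le_log hd0 (hD x y)
      rw [abs_le]
      constructor
      · linarith [neg_abs_le (Real.log r), abs_nonneg (Real.log D)]
      · linarith [le_abs_self (Real.log D), abs_nonneg (Real.log r)]
    have hone : 1 ≤ Λ ^ M * logModulus M d := by
      unfold logModulus
      rw [mul_one_div, one_le_div (by positivity)]
      exact Real.rpow_le_rpow hlog0.le hlog hM.le
    have hdiff : |u x - u y| ≤ 2 * |B| := by
      have := abs_sub (u x) (u y)
      linarith [hB x, hB y, le_abs_self B]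
    calc |u x - u y| ≤ 2 * |B| * (Λ ^ M * logModulus M d) := by
          refine hdiff.trans (le_mul_of_one_le_right (by positivity) hone)
      _ ≤ (C + 2 * |B| * Λ ^ M + 1) * logModulus M d := by
          nlinarith

end MetricEDist

/-! ### Compositions of blow-ups -/

theorem compMaps_succ {m : ℕ} {X : Fin (m + 1) → Type*} (f : ∀ j : Fin m, X j.succ → X j.castSucc)
    (j : Fin m) : compMaps f j.succ = compMaps f j.castSucc ∘ f j := by
  simp [compMaps]

end LogBlowUp

theorem mainTheorem6 {n m : ℕ} {X : Fin (m + 1) → Type*}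
    [∀ j, TopologicalSpace (X j)] [∀ j, T2Space (X j)] [∀ j, CompactSpace (X j)]
    [∀ j, ChartedSpace (LogBlowUp.Cn n) (X j)]
    [∀ j, IsManifold 𝓘(ℂ, LogBlowUp.Cn n) ω (X j)]
    (V : ∀ j : Fin m, Set (X j.castSucc))
    (f : ∀ j : Fin m, X j.succ → X j.castSucc)
    (hf : ∀ j : Fin m, LogBlowUp.IsBlowUp (n := n) (V j) (f j))
    (g₀ : LogBlowUp.SmoothMetric n (X 0))
    (gm : LogBlowUp.SmoothMetric n (X (Fin.last m)))
    (M : ℝ) (hM : 0 < M) (u : X 0 → ℝ)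
    (hu : LogBlowUp.LogContinuous gm M (u ∘ LogBlowUp.compMaps f (Fin.last m))) :
    LogBlowUp.LogContinuous g₀ M u := by
  have key : ∀ j : Fin (m + 1), LogBlowUp.LogContinuousInCharts n M (u ∘ LogBlowUp.compMaps f j) →
      LogBlowUp.LogContinuousInCharts n M u := by
    intro j
    induction j using Fin.induction with
    | zero => exact id
    | succ j ih =>
      intro h
      rw [LogBlowUp.compMaps_succ, ← Function.comp_assoc] at h
      exact ih ((hf j).logContinuousInCharts hM h)
  exact (key _ (hu.logContinuousInCharts hM)).logContinuous hM g₀
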